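/- Let $(M,\omega)$ be a closed symplectic manifold of dimension $2n$. Let $\mathrm{Symp}(M,\omega)$ be the group of symplectomorphisms of $(M,\omega)$ and let $\mathrm{Symp}_0(M,\omega)$ be its identity component, i.e. the group of symplectomorphisms that can be joined to the identity by a smooth path in $\mathrm{Symp}(M,\omega)$. A Hamiltonian path is a smooth path $(\psi_t)_{t\in[0,1]}$ in $\mathrm{Symp}(M,\omega)$ for which there is a smooth function $F:[0,1]\times M\to\mathbb{R}$, $F_t=F(t,\cdot)$, with $\omega\big(\tfrac{d}{dt}\psi_t(x),v\big)=dF_t(v)$ for all $t$, $x$ and $v\in T_{\psi_t(x)}M$; one says that $F$ generates the path. Let $\mathrm{Ham}(M,\omega)\subset\mathrm{Symp}_0(M,\omega)$ be the group of endpoints $\psi_1$ of Hamiltonian paths with $\psi_0=\mathrm{id}$. The Hofer metric on $\mathrm{Ham}(M,\omega)$ is $$d_H(f,g)=\inf\int_0^1\|F_t\|_\infty\,dt ,$$ where the infimum is over all Hamiltonian paths from $f$ to $g$ and all functions $F$ that generate them and are normalized by $\int_M F_t\,\omega^n=0$ for all $t$. Write $\rho(f)=d_H(\mathrm{id},f)$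 for the Hofer norm. Assume that there is some $\varphi\in\mathrm{Symp}_0(M,\omega)$ which is unbounded, i.e. $$\sup\{\rho(\varphi f\varphi^{-1}f^{-1}) \mid f\in\mathrm{Ham}(M,\omega)\}=\infty .$$ Then the Hofer metric does not extend to a bi-invariant metric on $\mathrm{Symp}_0(M,\omega)$: there is no metric $d$ on $\mathrm{Symp}_0(M,\omega)$ such that $d(\theta\varphi,\theta\psi)=d(\varphi\theta,\psi\theta)=d(\varphi,\psi)$ for all $\varphi,\psi,\theta\in\mathrm{Symp}_0(M,\omega)$ and $d(f,g)=d_H(f,g)$ for all $f,g\in\mathrm{Ham}(M,\omega)$. -/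

import Mathlib

open Set MeasureTheory
open scoped Manifold ContDiff ENNReal

noncomputable section

namespace Symplectic

/-- A field of alternating two-forms on a manifold `M` of dimension `m`, read in the preferred
chart at `x`: the pullback of `Ω` under the inverse of the chart. It is meaningful on the target
of the chart, which is open. -/
def chartForm {m : ℕ} {M : Type*} [TopologicalSpace M]
    [ChartedSpace (EuclideanSpace ℝ (Fin m)) M]
    (Ω : ∀ x : M, TangentSpace (𝓡 m) x [⋀^Fin 2]→L[ℝ] ℝ) (x : M) (y : EuclideanSpace ℝ (Fin m)) :
    EuclideanSpace ℝ (Fin m) [⋀^Fin 2]→L[ℝ] ℝ :=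
  (Ω ((extChartAt (𝓡 m) x).symm y)).compContinuousLinearMap
    (mfderiv (𝓡 m) (𝓡 m) (extChartAt (𝓡 m) x).symm y)

/-- A symplectic form: a smooth, closed, nondegenerate differential two-form. Smoothness and
closedness are expressed in charts. -/
structure SymplecticForm (n : ℕ) (M : Type*) [TopologicalSpace M]
    [ChartedSpace (EuclideanSpace ℝ (Fin (2 * n))) M] where
  /-- The value of the form at a point. -/
  form : ∀ x : M, TangentSpace (𝓡 (2 * n)) x [⋀^Fin 2]→L[ℝ] ℝ
  smooth : ∀ x : M, ContDiffOn ℝ ∞ (chartForm form x) (extChartAt (𝓡 (2 * n)) x).target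
  closed : ∀ x : M, ∀ y ∈ (extChartAt (𝓡 (2 * n)) x).target, extDeriv (chartForm form x) y = 0
  nondegenerate : ∀ (x : M) (v : TangentSpace (𝓡 (2 * n)) x),
    (∀ w : TangentSpace (𝓡 (2 * n)) x, form x ![v, w] = 0) → v = 0

variable {n : ℕ} {M : Type*} [TopologicalSpace M]
  [ChartedSpace (EuclideanSpace ℝ (Fin (2 * n))) M]

/-- The group `Symp(M, Ω)`: all diffeomorphisms `φ` of `M` with `φ^* Ω = Ω`, as a group of
bijections of `M` under composition. -/
def symp (Ω : SymplecticForm n M) : Subgroup (Equiv.Perm M) where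
  carrier := {φ | ContMDiff (𝓡 (2 * n)) (𝓡 (2 * n)) ∞ φ ∧
    ContMDiff (𝓡 (2 * n)) (𝓡 (2 * n)) ∞ φ.symm ∧
    ∀ x, (Ω.form (φ x)).compContinuousLinearMap (mfderiv (𝓡 (2 * n)) (𝓡 (2 * n)) φ x) = Ω.form x}
  one_mem' := by
    refine ⟨contMDiff_id, contMDiff_id, fun x => ?_⟩
    have h : mfderiv (𝓡 (2 * n)) (𝓡 (2 * n)) (⇑(1 : Equiv.Perm M)) x
        = ContinuousLinearMap.id ℝ (TangentSpace (𝓡 (2 * n)) x) := mfderiv_id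
    rw [h]
    rfl
  mul_mem' := by
    rintro φ ψ ⟨hφ, hφ', hφΩ⟩ ⟨hψ, hψ', hψΩ⟩
    refine ⟨hφ.comp hψ, hψ'.comp hφ', fun x => ?_⟩
    have h : mfderiv (𝓡 (2 * n)) (𝓡 (2 * n)) (⇑(φ * ψ)) x
        = (mfderiv (𝓡 (2 * n)) (𝓡 (2 * n)) φ (ψ x)).comp
          (mfderiv (𝓡 (2 * n)) (𝓡 (2 * n)) ψ x) :=
      mfderiv_comp x (hφ.mdifferentiableAt (by simp)) (hψ.mdifferentiableAt (by simp))
    rw [h, ← hψΩ x, ← hφΩ (ψ x)]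
    rfl
  inv_mem' := by
    rintro φ ⟨hφ, hφ', hφΩ⟩
    refine ⟨hφ', hφ, fun x => ?_⟩
    obtain ⟨y, rfl⟩ := φ.surjective x
    have hc : (mfderiv (𝓡 (2 * n)) (𝓡 (2 * n)) φ (φ.symm (φ y))).comp
        (mfderiv (𝓡 (2 * n)) (𝓡 (2 * n)) φ.symm (φ y))
        = ContinuousLinearMap.id ℝ (TangentSpace (𝓡 (2 * n)) (φ y)) := by
      rw [← mfderiv_comp (φ y) (hφ.mdifferentiableAt (by simp)) (hφ'.mdifferentiableAt (by simp))]
      have : (φ ∘ φ.symm : M → M) = id := by ext z; simp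
      rw [this]
      exact mfderiv_id
    have h1 := hφΩ (φ.symm (φ y))
    change (Ω.form (φ.symm (φ y))).compContinuousLinearMap
      (mfderiv (𝓡 (2 * n)) (𝓡 (2 * n)) φ.symm (φ y)) = Ω.form (φ y)
    rw [← h1]
    ext v
    change Ω.form (φ (φ.symm (φ y))) (fun i =>
      ((mfderiv (𝓡 (2 * n)) (𝓡 (2 * n)) φ (φ.symm (φ y))).comp
        (mfderiv (𝓡 (2 * n)) (𝓡 (2 * n)) φ.symm (φ y))) (v i)) = _
    rw [hc]
    have e : φ (φ.symm (φ y)) = φ y := by simp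
    change Ω.form (φ (φ.symm (φ y))) (v : Fin 2 → EuclideanSpace ℝ (Fin (2 * n)))
      = Ω.form (φ y) (v : Fin 2 → EuclideanSpace ℝ (Fin (2 * n)))
    rw [e]

/-- A symplectic isotopy `(ψ_t)`, `t ∈ [0, 1]`: a smooth path in `Symp(M, Ω)`, that is, every
`ψ_t` is a symplectomorphism and `(t, x) ↦ (t, ψ_t x)` is a diffeomorphism of `[0, 1] × M`.
Values of `ψ` at times outside `[0, 1]` are irrelevant. -/
structure IsSymplecticIsotopy (Ω : SymplecticForm n M) (ψ : ℝ → Equiv.Perm M) : Prop where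
  mem_symp : ∀ t ∈ Icc (0 : ℝ) 1, ψ t ∈ symp Ω
  smooth : ContMDiffOn (𝓘(ℝ, ℝ).prod (𝓡 (2 * n))) (𝓡 (2 * n)) ∞
    (fun p : ℝ × M => ψ p.1 p.2) (Icc (0 : ℝ) 1 ×ˢ univ)
  smooth_symm : ContMDiffOn (𝓘(ℝ, ℝ).prod (𝓡 (2 * n))) (𝓡 (2 * n)) ∞
    (fun p : ℝ × M => (ψ p.1).symm p.2) (Icc (0 : ℝ) 1 ×ˢ univ)

/-- The identity component `Symp_0(M, Ω)`: the symplectomorphisms that can be joined to the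
identity by a smooth path in `Symp(M, Ω)`. -/
def symp₀ (Ω : SymplecticForm n M) : Subgroup (Equiv.Perm M) where
  carrier := {φ | ∃ ψ : ℝ → Equiv.Perm M, IsSymplecticIsotopy Ω ψ ∧ ψ 0 = 1 ∧ ψ 1 = φ}
  one_mem' := ⟨fun _ => 1, ⟨fun _ _ => one_mem _, contMDiff_snd.contMDiffOn,
    contMDiff_snd.contMDiffOn⟩, rfl, rfl⟩
  mul_mem' := by
    rintro _ _ ⟨ψ, hψ, h0, rfl⟩ ⟨χ, hχ, k0, rfl⟩
    refine ⟨fun t => ψ t * χ t, ⟨fun t ht => mul_mem (hψ.mem_symp t ht) (hχ.mem_symp t ht), ?_, ?_⟩,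
      by simp [h0, k0], rfl⟩
    · exact hψ.smooth.comp (contMDiff_fst.contMDiffOn.prodMk hχ.smooth)
        (fun p hp => ⟨hp.1, mem_univ _⟩)
    · exact hχ.smooth_symm.comp (contMDiff_fst.contMDiffOn.prodMk hψ.smooth_symm)
        (fun p hp => ⟨hp.1, mem_univ _⟩)
  inv_mem' := by
    rintro _ ⟨ψ, hψ, h0, rfl⟩
    exact ⟨fun t => (ψ t)⁻¹, ⟨fun t ht => inv_mem (hψ.mem_symp t ht), hψ.smooth_symm, hψ.smooth⟩,
      by simp [h0], rfl⟩

/-- `ψ` is a Hamiltonian path generated by the time-dependent function `H`: it is a symplectic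
isotopy, `H` is smooth on `[0, 1] × M`, and `Ω(d/dt ψ_t(x), v) = dH_t(v)` for every tangent vector
`v` at `ψ_t(x)`. -/
structure IsHamiltonianPath (Ω : SymplecticForm n M) (ψ : ℝ → Equiv.Perm M) (H : ℝ → M → ℝ) :
    Prop extends IsSymplecticIsotopy Ω ψ where
  smooth_ham : ContMDiffOn (𝓘(ℝ, ℝ).prod (𝓡 (2 * n))) 𝓘(ℝ, ℝ) ∞
    (fun p : ℝ × M => H p.1 p.2) (Icc (0 : ℝ) 1 ×ˢ univ)
  generates : ∀ t ∈ Icc (0 : ℝ) 1, ∀ (x : M) (v : TangentSpace (𝓡 (2 * n)) (ψ t x)),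
    Ω.form (ψ t x)
      ![mfderivWithin 𝓘(ℝ, ℝ) (𝓡 (2 * n)) (fun s : ℝ => ψ s x) (Icc 0 1) t (1 : ℝ), v]
      = mfderiv (𝓡 (2 * n)) 𝓘(ℝ, ℝ) (H t) (ψ t x) v

/-- `Ham(M, Ω)`: the endpoints of the Hamiltonian paths that start at the identity. -/
def ham (Ω : SymplecticForm n M) : Set (Equiv.Perm M) :=
  {f | ∃ ψ H, IsHamiltonianPath Ω ψ H ∧ ψ 0 = 1 ∧ ψ 1 = f}

theorem ham_subset_symp₀ (Ω : SymplecticForm n M) {f : Equiv.Perm M} (hf : f ∈ ham Ω) :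
    f ∈ symp₀ Ω := by
  obtain ⟨ψ, H, h, h0, h1⟩ := hf
  exact ⟨ψ, h.toIsSymplecticIsotopy, h0, h1⟩

/-- The density of the volume form `Ω ^ n` in the preferred chart at `x`: with `W` the matrix of
`Ω` in the chart, `Ω ^ n = n! Pf(W) dx_1 ∧ ⋯ ∧ dx_{2n}` and `|Pf(W)| = √(det W)`. -/
def volumeDensity (Ω : SymplecticForm n M) (x : M) (y : EuclideanSpace ℝ (Fin (2 * n))) : ℝ :=
  n.factorial * √(Matrix.of fun i j : Fin (2 * n) => chartForm Ω.form x y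
    ![EuclideanSpace.single i (1 : ℝ), EuclideanSpace.single j (1 : ℝ)]).det

/-- The Borel measure on `M` given by the volume form `Ω ^ n` (`M` being oriented by `Ω ^ n`).
The member of the supremum with index `x` is its restriction to the domain of the chart at `x`,
and the supremum glues these restrictions together. -/
def volumeMeasure (Ω : SymplecticForm n M) : @Measure M (borel M) :=
  letI : MeasurableSpace M := borel M
  ⨆ x : M, Measure.map (extChartAt (𝓡 (2 * n)) x).symm
    ((volume.restrict (extChartAt (𝓡 (2 * n)) x).target).withDensity
      fun y => ENNReal.ofReal (volumeDensity Ω x y))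

/-- The time-dependent function `H` is normalized: `∫_M H_t Ω^n = 0` for all `t ∈ [0, 1]`. -/
def IsNormalized (Ω : SymplecticForm n M) (H : ℝ → M → ℝ) : Prop :=
  letI : MeasurableSpace M := borel M
  ∀ t ∈ Icc (0 : ℝ) 1, ∫ x, H t x ∂(volumeMeasure Ω) = 0

/-- The length `∫_0^1 ‖H_t‖_∞ dt` of a Hamiltonian path generated by the normalized function
`H`. -/
def hoferLength (H : ℝ → M → ℝ) : ℝ≥0∞ :=
  ∫⁻ t in Icc (0 : ℝ) 1, ⨆ x : M, ‖H t x‖ₑ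

/-- The Hofer distance of `f` and `g`: the infimum of the lengths of the Hamiltonian paths from
`f` to `g`. -/
def hoferDist (Ω : SymplecticForm n M) (f g : Equiv.Perm M) : ℝ≥0∞ :=
  ⨅ (ψ : ℝ → Equiv.Perm M) (H : ℝ → M → ℝ)
    (_ : IsHamiltonianPath Ω ψ H ∧ IsNormalized Ω H ∧ ψ 0 = f ∧ ψ 1 = g), hoferLength H

/-- The Hofer norm `ρ(f)`, the Hofer distance of the identity and `f`. -/
def hoferNorm (Ω : SymplecticForm n M) (f : Equiv.Perm M) : ℝ≥0∞ :=
  hoferDist Ω 1 f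

/-- `r(φ)`, the supremum over `f ∈ Ham(M, Ω)` of the Hofer norm of `φ f φ⁻¹ f⁻¹`. -/
def commutatorRadius (Ω : SymplecticForm n M) (φ : Equiv.Perm M) : ℝ≥0∞ :=
  ⨆ f ∈ ham Ω, hoferNorm Ω (φ * f * φ⁻¹ * f⁻¹)

/-- A symplectomorphism `φ` is bounded if `r(φ) < ∞`. -/
def IsBoundedSymp (Ω : SymplecticForm n M) (φ : Equiv.Perm M) : Prop :=
  commutatorRadius Ω φ < ⊤

/-- A distance function on a group is bi-invariant if left and right translations are
isometries. -/
def IsBiInvariant {G : Type*} [Group G] (d : G → G → ℝ) : Prop :=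
  ∀ θ φ ψ : G, d (θ * φ) (θ * ψ) = d φ ψ ∧ d (φ * θ) (ψ * θ) = d φ ψ

/-- The distance function `d` on `Symp_0(M, Ω)` agrees with the Hofer distance on
`Ham(M, Ω)`. -/
def ExtendsHofer (Ω : SymplecticForm n M) (d : symp₀ Ω → symp₀ Ω → ℝ) : Prop :=
  ∀ (f g : Equiv.Perm M) (hf : f ∈ ham Ω) (hg : g ∈ ham Ω),
    ENNReal.ofReal (d ⟨f, ham_subset_symp₀ Ω hf⟩ ⟨g, ham_subset_symp₀ Ω hg⟩) = hoferDist Ω f g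

end Symplectic

end

namespace Symplectic

variable {n : ℕ} {M : Type*} [TopologicalSpace M]
  [ChartedSpace (EuclideanSpace ℝ (Fin (2 * n))) M]

/-! A bi-invariant extension `d` would make every `φ` bounded. For Hamiltonian `f`, the points `f`
and `φ f φ⁻¹` are at `d`-distance at most `d(1, φ) + d(1, φ⁻¹)`, whatever `f` is
(`IsBiInvariant.dist_conj_le`). Both points are Hamiltonian (`conj_mem_ham`), so this distance is
their Hofer distance, and right translation by `f⁻¹` (`hoferDist_mul_right_le`) bounds the Hofer
norm of `φ f φ⁻¹ f⁻¹` by it. -/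

/-- The right translate of a symplectic isotopy by a symplectomorphism is a symplectic isotopy. -/
theorem IsSymplecticIsotopy.mul_right {Ω : SymplecticForm n M} {ψ : ℝ → Equiv.Perm M}
    (hψ : IsSymplecticIsotopy Ω ψ) {θ : Equiv.Perm M} (hθ : θ ∈ symp Ω) :
    IsSymplecticIsotopy Ω (fun t => ψ t * θ) where
  mem_symp t ht := mul_mem (hψ.mem_symp t ht) hθ
  smooth := hψ.smooth.comp
    (contMDiff_fst.prodMk (hθ.1.comp contMDiff_snd)).contMDiffOn (fun _ hp => ⟨hp.1, mem_univ _⟩)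
  smooth_symm := hθ.2.1.comp_contMDiffOn hψ.smooth_symm

/-- The left translate of a symplectic isotopy by a symplectomorphism is a symplectic isotopy. -/
theorem IsSymplecticIsotopy.mul_left {Ω : SymplecticForm n M} {ψ : ℝ → Equiv.Perm M}
    (hψ : IsSymplecticIsotopy Ω ψ) {θ : Equiv.Perm M} (hθ : θ ∈ symp Ω) :
    IsSymplecticIsotopy Ω (fun t => θ * ψ t) where
  mem_symp t ht := mul_mem hθ (hψ.mem_symp t ht)
  smooth := hθ.1.comp_contMDiffOn hψ.smooth
  smooth_symm := hψ.smooth_symm.comp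
    (contMDiff_fst.prodMk (hθ.2.1.comp contMDiff_snd)).contMDiffOn
    (fun _ hp => ⟨hp.1, mem_univ _⟩)

/-- Right translation by a symplectomorphism does not change the generating function of a
Hamiltonian path. -/
theorem IsHamiltonianPath.mul_right {Ω : SymplecticForm n M} {ψ : ℝ → Equiv.Perm M}
    {H : ℝ → M → ℝ} (h : IsHamiltonianPath Ω ψ H) {θ : Equiv.Perm M} (hθ : θ ∈ symp Ω) :
    IsHamiltonianPath Ω (fun t => ψ t * θ) H where
  toIsSymplecticIsotopy := h.toIsSymplecticIsotopy.mul_right hθ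
  smooth_ham := h.smooth_ham
  -- The orbit of `x` under the translated path is the orbit of `θ x` under `ψ`.
  generates t ht x v := h.generates t ht (θ x) v

/-- Each orbit of a symplectic isotopy is differentiable in time. -/
theorem IsSymplecticIsotopy.mdifferentiableWithinAt {Ω : SymplecticForm n M}
    {ψ : ℝ → Equiv.Perm M} (hψ : IsSymplecticIsotopy Ω ψ) {t : ℝ} (ht : t ∈ Icc (0 : ℝ) 1)
    (x : M) :
    MDifferentiableWithinAt 𝓘(ℝ, ℝ) (𝓡 (2 * n)) (fun s : ℝ => ψ s x) (Icc 0 1) t := by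
  have h : ContMDiffOn 𝓘(ℝ, ℝ) (𝓡 (2 * n)) ∞ (fun s : ℝ => ψ s x) (Icc 0 1) :=
    hψ.smooth.comp (contMDiff_id.prodMk contMDiff_const).contMDiffOn
      (fun s hs => ⟨hs, mem_univ _⟩)
  exact (h t ht).mdifferentiableWithinAt (by simp)

/-- A generating function of a Hamiltonian path is differentiable in space. -/
theorem IsHamiltonianPath.mdifferentiableAt_ham {Ω : SymplecticForm n M} {ψ : ℝ → Equiv.Perm M}
    {H : ℝ → M → ℝ} (h : IsHamiltonianPath Ω ψ H) {t : ℝ} (ht : t ∈ Icc (0 : ℝ) 1) (x : M) :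
    MDifferentiableAt (𝓡 (2 * n)) 𝓘(ℝ, ℝ) (H t) x := by
  have h' : ContMDiffOn (𝓡 (2 * n)) 𝓘(ℝ, ℝ) ∞ (H t) univ :=
    h.smooth_ham.comp (contMDiff_const.prodMk contMDiff_id).contMDiffOn
      (fun y _ => ⟨ht, mem_univ _⟩)
  exact (contMDiffOn_univ.1 h' x).mdifferentiableAt (by simp)

/-- The conjugate of a Hamiltonian path by a symplectomorphism `θ` is a Hamiltonian path, generated
by `H_t ∘ θ⁻¹`. -/
theorem IsHamiltonianPath.conj {Ω : SymplecticForm n M} {ψ : ℝ → Equiv.Perm M}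
    {H : ℝ → M → ℝ} (h : IsHamiltonianPath Ω ψ H) {θ : Equiv.Perm M} (hθ : θ ∈ symp Ω) :
    IsHamiltonianPath Ω (fun t => θ * ψ t * θ⁻¹) (fun t x => H t (θ.symm x)) where
  toIsSymplecticIsotopy := (h.toIsSymplecticIsotopy.mul_left hθ).mul_right (inv_mem hθ)
  smooth_ham := h.smooth_ham.comp
    (contMDiff_fst.prodMk (hθ.2.1.comp contMDiff_snd)).contMDiffOn (fun _ hp => ⟨hp.1, mem_univ _⟩)
  generates t ht x v := by
    have hθd : ∀ z, MDifferentiableAt (𝓡 (2 * n)) (𝓡 (2 * n)) θ z := fun z =>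
      hθ.1.mdifferentiableAt (by simp)
    have hθd' : ∀ z, MDifferentiableAt (𝓡 (2 * n)) (𝓡 (2 * n)) θ.symm z := fun z =>
      hθ.2.1.mdifferentiableAt (by simp)
    have hsymm : ∀ z, θ.symm (θ z) = z := θ.symm_apply_apply
    set y : M := ψ t (θ.symm x) with hy
    change TangentSpace (𝓡 (2 * n)) (θ y) at v
    have hut : UniqueMDiffWithinAt 𝓘(ℝ, ℝ) (Icc (0 : ℝ) 1) t :=
      (uniqueDiffOn_Icc zero_lt_one t ht).uniqueMDiffWithinAt
    have hvel : mfderivWithin 𝓘(ℝ, ℝ) (𝓡 (2 * n)) (fun s : ℝ => θ (ψ s (θ.symm x))) (Icc 0 1) t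
        = (mfderiv (𝓡 (2 * n)) (𝓡 (2 * n)) θ y).comp
          (mfderivWithin 𝓘(ℝ, ℝ) (𝓡 (2 * n)) (fun s : ℝ => ψ s (θ.symm x)) (Icc 0 1) t) :=
      mfderiv_comp_mfderivWithin t (hθd y)
        (h.toIsSymplecticIsotopy.mdifferentiableWithinAt ht _) hut
    -- Pulling `v` back by `θ` lets `θ^* Ω = Ω` reduce the identity at `θ y` to the one for `ψ` at
    -- `y`.
    let w : TangentSpace (𝓡 (2 * n)) y := mfderiv (𝓡 (2 * n)) (𝓡 (2 * n)) θ.symm (θ y) v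
    have hham : mfderiv (𝓡 (2 * n)) 𝓘(ℝ, ℝ) (fun z => H t (θ.symm z)) (θ y) v
        = mfderiv (𝓡 (2 * n)) 𝓘(ℝ, ℝ) (H t) y w := by
      have hc : mfderiv (𝓡 (2 * n)) 𝓘(ℝ, ℝ) (H t ∘ θ.symm) (θ y)
          = (mfderiv (𝓡 (2 * n)) 𝓘(ℝ, ℝ) (H t) (θ.symm (θ y))).comp
            (mfderiv (𝓡 (2 * n)) (𝓡 (2 * n)) θ.symm (θ y)) :=
        mfderiv_comp (θ y) (h.mdifferentiableAt_ham ht _) (hθd' _)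
      rw [hsymm y] at hc
      exact DFunLike.congr_fun hc v
    have hw : mfderiv (𝓡 (2 * n)) (𝓡 (2 * n)) θ y w = v := by
      have hc : mfderiv (𝓡 (2 * n)) (𝓡 (2 * n)) (θ ∘ θ.symm) (θ y)
          = (mfderiv (𝓡 (2 * n)) (𝓡 (2 * n)) θ (θ.symm (θ y))).comp
            (mfderiv (𝓡 (2 * n)) (𝓡 (2 * n)) θ.symm (θ y)) :=
        mfderiv_comp (θ y) (hθd _) (hθd' _)
      have hid : (θ ∘ θ.symm : M → M) = id := θ.self_comp_symm
      rw [hsymm y, hid, mfderiv_id] at hc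
      exact (DFunLike.congr_fun hc v).symm
    have hgen := h.generates t ht (θ.symm x) w
    have hΩ := DFunLike.congr_fun (hθ.2.2 y)
      ![mfderivWithin 𝓘(ℝ, ℝ) (𝓡 (2 * n)) (fun s : ℝ => ψ s (θ.symm x)) (Icc 0 1) t (1 : ℝ), w]
    refine Eq.trans ?_ ((hΩ.trans hgen).trans hham.symm)
    change Ω.form (θ y) ![mfderivWithin 𝓘(ℝ, ℝ) (𝓡 (2 * n))
      (fun s : ℝ => θ (ψ s (θ.symm x))) (Icc 0 1) t (1 : ℝ), v] = Ω.form (θ y) _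
    congr 1
    funext i
    fin_cases i
    · exact DFunLike.congr_fun hvel (1 : ℝ)
    · exact hw.symm

theorem symp₀_le_symp (Ω : SymplecticForm n M) : symp₀ Ω ≤ symp Ω := by
  rintro _ ⟨ψ, hψ, -, rfl⟩
  exact hψ.mem_symp 1 (right_mem_Icc.2 zero_le_one)

/-- `Ham(M, Ω)` is invariant under conjugation by symplectomorphisms. -/
theorem conj_mem_ham {Ω : SymplecticForm n M} {θ f : Equiv.Perm M} (hθ : θ ∈ symp Ω)
    (hf : f ∈ ham Ω) : θ * f * θ⁻¹ ∈ ham Ω := by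
  obtain ⟨ψ, H, h, h0, rfl⟩ := hf
  -- `ham` does not ask for normalized generators, so the mean of `H_t ∘ θ⁻¹` plays no role.
  exact ⟨_, _, h.conj hθ, by simp [h0], rfl⟩

/-- Right translations by symplectomorphisms do not increase the Hofer distance. -/
theorem hoferDist_mul_right_le {Ω : SymplecticForm n M} (f g : Equiv.Perm M) {θ : Equiv.Perm M}
    (hθ : θ ∈ symp Ω) : hoferDist Ω (f * θ) (g * θ) ≤ hoferDist Ω f g := by
  refine le_iInf fun ψ => le_iInf fun H => le_iInf fun h => ?_
  obtain ⟨hH, hN, rfl, rfl⟩ := h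
  -- The generator `H` is unchanged, hence so are its normalization and its length.
  exact iInf_le_of_le (fun t => ψ t * θ) <| iInf_le_of_le H <|
    iInf_le_of_le ⟨hH.mul_right hθ, hN, rfl, rfl⟩ le_rfl

/-- For a bi-invariant metric on a group, the distance of `f` and its conjugate by `φ` is bounded
independently of `f`. -/
theorem IsBiInvariant.dist_conj_le {G : Type*} [Group G] (m : MetricSpace G)
    (h : IsBiInvariant m.dist) (φ f : G) :
    m.dist f (φ * f * φ⁻¹) ≤ m.dist 1 φ + m.dist 1 φ⁻¹ := by
  -- The intermediate point is `φ f`: it differs from `f` by a left factor `φ` and from `φ f φ⁻¹` by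
  -- a right factor `φ⁻¹`.
  have h1 := (h f 1 φ).2
  have h2 := (h (φ * f) 1 φ⁻¹).1
  rw [one_mul] at h1
  rw [mul_one] at h2
  rw [← h1, ← h2]
  exact m.dist_triangle _ _ _

end Symplectic

theorem mainTheorem2 (n : ℕ) (M : Type*) [TopologicalSpace M] [T2Space M] [CompactSpace M]
    [ChartedSpace (EuclideanSpace ℝ (Fin (2 * n))) M] [IsManifold (𝓡 (2 * n)) ∞ M]
    (Ω : Symplectic.SymplecticForm n M)
    (h : ∃ φ ∈ Symplectic.symp₀ Ω, ¬ Symplectic.IsBoundedSymp Ω φ) :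
    ¬ ∃ m : MetricSpace (Symplectic.symp₀ Ω),
      Symplectic.IsBiInvariant m.dist ∧ Symplectic.ExtendsHofer Ω m.dist := by
  rintro ⟨m, hinv, hext⟩
  obtain ⟨φ, hφ, hunb⟩ := h
  refine hunb (lt_of_le_of_lt (iSup₂_le fun f hf => ?_)
    (ENNReal.ofReal_lt_top (r := m.dist 1 ⟨φ, hφ⟩ + m.dist 1 (⟨φ, hφ⟩ : Symplectic.symp₀ Ω)⁻¹)))
  have hfs := Symplectic.ham_subset_symp₀ Ω hf
  -- Translating inside `hoferDist` means that `d` is compared with it only at `f` and `φ f φ⁻¹`;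
  -- that the commutator is Hamiltonian, or that `ham Ω` is closed under products, is not needed.
  have hle := Symplectic.hoferDist_mul_right_le (Ω := Ω) f (φ * f * φ⁻¹)
    (inv_mem (Symplectic.symp₀_le_symp Ω hfs))
  rw [mul_inv_cancel] at hle
  refine hle.trans ?_
  rw [← hext f (φ * f * φ⁻¹) hf
    (Symplectic.conj_mem_ham (Symplectic.symp₀_le_symp Ω hφ) hf)]
  exact ENNReal.ofReal_le_ofReal (hinv.dist_conj_le m ⟨φ, hφ⟩ ⟨f, hfs⟩)
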